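/- For a finite field $\mathbb F_q$ with $q$ elements and $t\in\mathbb F_q^*$ let $S_t=\{x\in\mathbb F_q^2: x_1^2+x_2^2=t\}$, and write $S_t(\cdot)$ also for its indicator function. For $f:\mathbb F_q^2\to\mathbb R$ let $\|f\|_p=\big(q^{-2}\sum_{x\in\mathbb F_q^2}|f(x)|^p\big)^{1/p}$ if $1\le p<\infty$ and $\|f\|_\infty=\max_x|f(x)|$. For non-negative $f_1,\dots,f_4:\mathbb F_q^2\to\mathbb R$ put $$\diamondsuit_t(f_1,f_2,f_3,f_4)=\frac{1}{q^2|S_t|}\sum_{x^1,x^2,x^3,x^4\in\mathbb F_q^2}S_t(x^1-x^2)S_t(x^2-x^3)S_t(x^3-x^4)S_t(x^4-x^1)S_t(x^1-x^3)\prod_{i=1}^4f_i(x^i),$$ $$Y_t(f_1,f_2,f_3,f_4)=\frac{1}{q^2|S_t|^3}\sum_{x^1,x^2,x^3,x^4\in\mathbb F_q^2}S_t(x^3-x^1)S_t(x^3-x^2)S_t(x^3-x^4)\prod_{i=1}^4f_i(x^i).$$ **Theorem.** Let $1\le p_1,p_2,p_3,p_4\le\infty$. Consider any family of pairs $(\mathbb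 F_q,t)$, where $\mathbb F_q$ is a finite field of odd characteristic in which $3$ is a square and $t\in\mathbb F_q^*$ (for instance, the family of all such pairs). Suppose that there is a constant $C>0$ such that, for every pair $(\mathbb F_q,t)$ of the family, $$\diamondsuit_t(f_1,f_2,f_3,f_4)\le C\,\|f_1\|_{p_1}\|f_2\|_{p_2}\|f_3\|_{p_3}\|f_4\|_{p_4}\quad\text{for all non-negative } f_1,\dots,f_4:\mathbb F_q^2\to\mathbb R.$$ Then there is a constant $C'>0$ such that, for every pair $(\mathbb F_q,t)$ of the family, $$Y_t(f_1,f_2,f_3,f_4)\le C'\,\|f_1\|_{p_1}\|f_2\|_{p_2}\|f_3\|_{p_3}\|f_4\|_{p_4}\quad\text{for all non-negative } f_1,\dots,f_4:\mathbb F_q^2\to\mathbb R.$$ -/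

import Mathlib

open scoped ENNReal

noncomputable section

namespace FiniteFieldForms

/-- The circle `S_t = {x ∈ F² : x₁² + x₂² = t}`. -/
def circle {F : Type*} [Field F] (t : F) : Set (Fin 2 → F) :=
  {x | x 0 ^ 2 + x 1 ^ 2 = t}

/-- The indicator function of the circle `S_t`, with real values. -/
def circleInd {F : Type*} [Field F] (t : F) (x : Fin 2 → F) : ℝ :=
  (circle t).indicator (fun _ => 1) x

/-- The `L^p` norm, `1 ≤ p ≤ ∞`, for the normalized counting measure on a finite set `α`
(the plane `F²` below, so that `Fintype.card α = q²`). -/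
def normLp {α : Type*} [Fintype α] (p : ℝ≥0∞) (f : α → ℝ) : ℝ :=
  if p = ∞ then ⨆ x, |f x|
  else ((Fintype.card α : ℝ)⁻¹ * ∑ x, |f x| ^ p.toReal) ^ (1 / p.toReal)

/-- The form of the graph `C₄` + diagonal on `F²`: the four sides of the cycle
`x⁰ x¹ x² x³` and the diagonal `x⁰ x²` all have length `t`. In dimension two the normalizing
factor is `q² |S_t|`. -/
def diamondForm {F : Type*} [Field F] [Fintype F] (t : F)
    (f : Fin 4 → (Fin 2 → F) → ℝ) : ℝ :=
  1 / ((Fintype.card F : ℝ) ^ 2 * ((circle t).ncard : ℝ)) *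
    ∑ x : Fin 4 → (Fin 2 → F),
      circleInd t (x 0 - x 1) * circleInd t (x 1 - x 2) * circleInd t (x 2 - x 3) *
        circleInd t (x 3 - x 0) * circleInd t (x 0 - x 2) * ∏ l, f l (x l)

/-- The form of the `Y`-shaped graph on `F²`, with centre the third vertex `x²`;
the normalizing factor is `q² |S_t|³`. -/
def yForm {F : Type*} [Field F] [Fintype F] (t : F)
    (f : Fin 4 → (Fin 2 → F) → ℝ) : ℝ :=
  1 / ((Fintype.card F : ℝ) ^ 2 * ((circle t).ncard : ℝ) ^ 3) *
    ∑ x : Fin 4 → (Fin 2 → F),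
      circleInd t (x 2 - x 0) * circleInd t (x 2 - x 1) * circleInd t (x 2 - x 3) *
        ∏ l, f l (x l)

/-- For a family of finite fields `F i` and forms `Λ i` in four functions on `(F i)²`:
`Λ(p₁, p₂, p₃, p₄) ≲ 1`, that is, one constant `C`, the same for all members of the family,
bounds all the forms on non-negative functions. -/
def UniformlyBounded {ι : Type*} (F : ι → Type*) [∀ i, Fintype (F i)]
    (Λ : ∀ i, (Fin 4 → (Fin 2 → F i) → ℝ) → ℝ) (p : Fin 4 → ℝ≥0∞) : Prop :=
  ∃ C : ℝ, 0 < C ∧ ∀ (i : ι) (f : Fin 4 → (Fin 2 → F i) → ℝ), (∀ l x, 0 ≤ f l x) →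
    Λ i f ≤ C * ∏ l, normLp (p l) (f l)

end FiniteFieldForms

end

/-! Write `aₗ = 1 / pₗ`. Testing the diamond form on the equilateral triangles of side `t` with one
vertex at the origin, which exist because `3` is a square, gives `q ^ (aₗ + ∑ₖ aₖ - 2) ≲ 1` for
every vertex `l`. If one of these exponents is positive, then `q` is bounded along the family and
there is nothing to prove. Otherwise, two circles of radius `t` meet in at most two points, so
averaging over circles maps `L^{3/2}` to `L^3`. By Hölder's inequality this bounds the `Y` form as
long as `aⱼ ≤ 2/3` for every leaf `j`, and interpolation with the trivial estimate at the vertex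
`aⱼ = 1` of the exponent region covers the remaining case. -/

open scoped ENNReal BigOperators

noncomputable section

namespace FiniteFieldForms

/-! ### Hölder's inequality for averages -/

section Holder

variable {α : Type*} {s : Finset α}

theorem expect_prod_rpow_le_one {ι : Type*} [Fintype ι] {w : ι → ℝ} {G : ι → α → ℝ}
    (hw : ∀ i, 0 ≤ w i) (hsum : ∑ i, w i ≤ 1) (hG : ∀ i x, 0 ≤ G i x)
    (hmean : ∀ i, 𝔼 x ∈ s, G i x ≤ 1) : 𝔼 x ∈ s, ∏ i, G i x ^ w i ≤ 1 := by
  obtain rfl | hs := s.eq_empty_or_nonempty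
  · simp
  -- The missing weight `1 - ∑ i, w i` goes to an additional function, the constant `1`.
  have hamgm (x : α) : ∏ i, G i x ^ w i ≤ (1 - ∑ i, w i) + ∑ i, w i * G i x := by
    have := Real.geom_mean_le_arith_mean_weighted (Finset.univ : Finset (Option ι))
      (fun o => o.elim (1 - ∑ i, w i) w) (fun o => o.elim 1 fun i => G i x)
      (by rintro (_ | i) _ <;> simp [hw, hsum]) (by simp) (by rintro (_ | i) _ <;> simp [hG])
    simpa using this
  calc 𝔼 x ∈ s, ∏ i, G i x ^ w i
      ≤ 𝔼 x ∈ s, ((1 - ∑ i, w i) + ∑ i, w i * G i x) :=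
        Finset.expect_le_expect fun x _ => hamgm x
    _ = (1 - ∑ i, w i) + ∑ i, w i * 𝔼 x ∈ s, G i x := by
        simp only [Finset.expect_add_distrib, Finset.expect_const hs, Finset.expect_sum_comm,
          Finset.mul_expect]
    _ ≤ (1 - ∑ i, w i) + ∑ i, w i * 1 := by gcongr with i; exacts [hw i, hmean i]
    _ = 1 := by simp

theorem expect_prod_rpow_le {ι : Type*} [Fintype ι] {w : ι → ℝ} {G : ι → α → ℝ}
    (hw : ∀ i, 0 ≤ w i) (hsum : ∑ i, w i ≤ 1) (hG : ∀ i x, 0 ≤ G i x) :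
    𝔼 x ∈ s, ∏ i, G i x ^ w i ≤ ∏ i, (𝔼 x ∈ s, G i x) ^ w i := by
  set M : ι → ℝ := fun i => 𝔼 x ∈ s, G i x
  have hM (i : ι) : 0 ≤ M i := Finset.expect_nonneg fun x _ => hG i x
  have hfactor (i : ι) : ∀ x ∈ s, G i x = M i * (G i x / M i) := fun x hx => by
    refine (mul_div_cancel_of_imp' fun h => ?_).symm
    exact (Finset.expect_eq_zero_iff_of_nonneg fun x _ => hG i x).1 h x hx
  have hnormalized : 𝔼 x ∈ s, ∏ i, (G i x / M i) ^ w i ≤ 1 :=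
    expect_prod_rpow_le_one hw hsum (fun i x => div_nonneg (hG i x) (hM i)) fun i => by
      simp only [div_eq_mul_inv, ← Finset.expect_mul]
      exact mul_inv_le_one
  calc 𝔼 x ∈ s, ∏ i, G i x ^ w i
      = 𝔼 x ∈ s, (∏ i, M i ^ w i) * ∏ i, (G i x / M i) ^ w i := by
        refine Finset.expect_congr rfl fun x hx => ?_
        rw [← Finset.prod_mul_distrib]
        refine Finset.prod_congr rfl fun i _ => ?_
        rw [← Real.mul_rpow (hM i) (div_nonneg (hG i x) (hM i)), ← hfactor i x hx]
    _ = (∏ i, M i ^ w i) * 𝔼 x ∈ s, ∏ i, (G i x / M i) ^ w i := (Finset.mul_expect ..).symm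
    _ ≤ ∏ i, M i ^ w i :=
        mul_le_of_le_one_right (Finset.prod_nonneg fun i _ => Real.rpow_nonneg (hM i) _) hnormalized

theorem expect_rpow_le {F : α → ℝ} (hF : ∀ x, 0 ≤ F x) {a : ℝ} (ha₀ : 0 ≤ a) (ha₁ : a ≤ 1) :
    𝔼 x ∈ s, F x ^ a ≤ (𝔼 x ∈ s, F x) ^ a := by
  simpa using expect_prod_rpow_le (ι := Unit) (w := fun _ => a) (G := fun _ => F) (s := s)
    (fun _ => ha₀) (by simpa using ha₁) (fun _ => hF)

theorem expect_rpow_mul_rpow_le {F G : α → ℝ} (hF : ∀ x, 0 ≤ F x) (hG : ∀ x, 0 ≤ G x) {a b : ℝ}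
    (ha : 0 ≤ a) (hb : 0 ≤ b) (hab : a + b = 1) :
    𝔼 x ∈ s, F x ^ a * G x ^ b ≤ (𝔼 x ∈ s, F x) ^ a * (𝔼 x ∈ s, G x) ^ b := by
  simpa using expect_prod_rpow_le (ι := Fin 2) (w := ![a, b]) (G := ![F, G]) (s := s)
    (Fin.forall_fin_two.2 ⟨ha, hb⟩) (by simpa using hab.le) (Fin.forall_fin_two.2 ⟨hF, hG⟩)

theorem expect_rpow_mul_prod_rpow_le {ι : Type*} [Fintype ι] {E : α → ℝ} {G : ι → α → ℝ}
    (hE : ∀ x, 0 ≤ E x) (hG : ∀ i x, 0 ≤ G i x) {c : ℝ} {w : ι → ℝ} (hc : 0 ≤ c)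
    (hw : ∀ i, 0 ≤ w i) (hsum : c + ∑ i, w i ≤ 1) :
    𝔼 x ∈ s, E x ^ c * ∏ i, G i x ^ w i ≤
      (𝔼 x ∈ s, E x) ^ c * ∏ i, (𝔼 x ∈ s, G i x) ^ w i := by
  have := expect_prod_rpow_le (ι := Option ι) (s := s) (w := fun o => o.elim c w)
    (G := fun o => o.elim E G) (by rintro (_ | i); exacts [hc, hw i])
    (by simpa [Fintype.sum_option] using hsum) (by rintro (_ | i); exacts [hE, hG i])
  simpa [Fintype.prod_option] using this

end Holder

/-! ### Averages over neighbours -/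

theorem sum_offDiag_mul {α : Type*} (s : Finset α) (F : α → ℝ) :
    ∑ p ∈ s.offDiag, F p.1 * F p.2 = (∑ y ∈ s, F y) ^ 2 - ∑ y ∈ s, F y ^ 2 := by
  classical
  rw [eq_sub_iff_add_eq', sq, Finset.sum_mul_sum, ← Finset.sum_product', ← s.diag_union_offDiag,
    Finset.sum_union s.disjoint_diag_offDiag, Finset.sum_diag]
  simp only [sq]

theorem sum_rpow_two_thirds_pow_three_le {α : Type*} (s : Finset α) {F : α → ℝ}
    (hF : ∀ y, 0 ≤ F y) :
    (∑ y ∈ s, F y ^ (2 / 3 : ℝ)) ^ 3 ≤ s.card * (∑ y ∈ s, F y) ^ 2 := by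
  have hjensen : (𝔼 y ∈ s, F y ^ (2 / 3 : ℝ)) ^ 3 ≤ (𝔼 y ∈ s, F y) ^ 2 := calc
    (𝔼 y ∈ s, F y ^ (2 / 3 : ℝ)) ^ 3 ≤ ((𝔼 y ∈ s, F y) ^ (2 / 3 : ℝ)) ^ 3 :=
        pow_le_pow_left₀ (Finset.expect_nonneg fun y _ => Real.rpow_nonneg (hF y) _)
          (expect_rpow_le hF (by norm_num) (by norm_num)) 3
    _ = (𝔼 y ∈ s, F y) ^ 2 := by
        rw [← Real.rpow_mul_natCast (Finset.expect_nonneg fun y _ => hF y)]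
        norm_num
  simp only [← Finset.card_mul_expect]
  calc (s.card * 𝔼 y ∈ s, F y ^ (2 / 3 : ℝ)) ^ 3
      = s.card ^ 3 * (𝔼 y ∈ s, F y ^ (2 / 3 : ℝ)) ^ 3 := mul_pow ..
    _ ≤ s.card ^ 3 * (𝔼 y ∈ s, F y) ^ 2 := by gcongr
    _ = s.card * (s.card * 𝔼 y ∈ s, F y) ^ 2 := by ring

-- The largest value of `F` is split off: the square of the sum of the others is at most the
-- off-diagonal part of `(∑ F) ^ 2`.
theorem sum_rpow_two_thirds_pow_three_le_offDiag {α : Type*} (s : Finset α)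
    {F : α → ℝ} (hF : ∀ y, 0 ≤ F y) :
    (∑ y ∈ s, F y ^ (2 / 3 : ℝ)) ^ 3 ≤
      4 * (∑ y ∈ s, F y ^ 2 + s.card * ∑ p ∈ s.offDiag, F p.1 * F p.2) := by
  classical
  obtain rfl | hs := s.eq_empty_or_nonempty
  · simp
  obtain ⟨z, hz, hmax⟩ := s.exists_max_image F hs
  set r := s.erase z
  have hr : 0 ≤ ∑ y ∈ r, F y := Finset.sum_nonneg fun y _ => hF y
  have hsum : F z + ∑ y ∈ r, F y = ∑ y ∈ s, F y := Finset.add_sum_erase s F hz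
  have hsq : ∑ y ∈ s, F y ^ 2 ≤ F z * ∑ y ∈ s, F y := by
    rw [Finset.mul_sum]
    refine Finset.sum_le_sum fun y hy => ?_
    rw [sq]
    exact mul_le_mul_of_nonneg_right (hmax y hy) (hF y)
  have hrest : (∑ y ∈ r, F y) ^ 2 ≤ ∑ p ∈ s.offDiag, F p.1 * F p.2 := by
    rw [sum_offDiag_mul, ← hsum]
    rw [← hsum] at hsq
    nlinarith [mul_nonneg (hF z) hr]
  have htop : (F z ^ (2 / 3 : ℝ)) ^ 3 = F z ^ 2 := by
    rw [← Real.rpow_mul_natCast (hF z)]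
    norm_num
  calc (∑ y ∈ s, F y ^ (2 / 3 : ℝ)) ^ 3
      = (F z ^ (2 / 3 : ℝ) + ∑ y ∈ r, F y ^ (2 / 3 : ℝ)) ^ 3 := by
        rw [Finset.add_sum_erase s (fun y => F y ^ (2 / 3 : ℝ)) hz]
    _ ≤ 4 * ((F z ^ (2 / 3 : ℝ)) ^ 3 + (∑ y ∈ r, F y ^ (2 / 3 : ℝ)) ^ 3) :=
        (add_pow_le (Real.rpow_nonneg (hF z) _)
          (Finset.sum_nonneg fun y _ => Real.rpow_nonneg (hF y) _) 3).trans_eq (by norm_num)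
    _ ≤ 4 * (F z ^ 2 + r.card * (∑ y ∈ r, F y) ^ 2) := by
        rw [htop]
        gcongr
        exact sum_rpow_two_thirds_pow_three_le r hF
    _ ≤ 4 * (∑ y ∈ s, F y ^ 2 + s.card * ∑ p ∈ s.offDiag, F p.1 * F p.2) := by
        gcongr
        · exact Finset.single_le_sum (f := fun y => F y ^ 2) (fun y _ => sq_nonneg _) hz
        · exact s.erase_subset z

section NeighborAverage

variable {V : Type*} [Fintype V] {G : SimpleGraph V} [DecidableRel G.Adj] {m k : ℕ}

variable (G) in
/-- The average of `f` over the neighbours of `x`; it is `0` at an isolated vertex. -/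
def nbrAvg (f : V → ℝ) (x : V) : ℝ := 𝔼 y ∈ G.neighborFinset x, f y

theorem nbrAvg_nonneg {f : V → ℝ} (hf : ∀ y, 0 ≤ f y) (x : V) : 0 ≤ nbrAvg G f x :=
  Finset.expect_nonneg fun y _ => hf y

theorem nbrAvg_eq_sum_div (hG : G.IsRegularOfDegree m) (f : V → ℝ) (x : V) :
    nbrAvg G f x = (∑ y ∈ G.neighborFinset x, f y) / m := by
  rw [nbrAvg, Finset.expect_eq_sum_div_card, G.card_neighborFinset_eq_degree, hG.degree_eq]

theorem sum_sum_neighborFinset (hG : G.IsRegularOfDegree m) (f : V → ℝ) :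
    ∑ x, ∑ y ∈ G.neighborFinset x, f y = m * ∑ y, f y := by
  rw [Finset.sum_comm' (t' := Finset.univ) (s' := fun y => G.neighborFinset y)
    (by simp [G.adj_comm]), Finset.mul_sum]
  simp [hG.degree_eq]

theorem expect_nbrAvg_le (hG : G.IsRegularOfDegree m) {f : V → ℝ} (hf : ∀ x, 0 ≤ f x) :
    𝔼 x, nbrAvg G f x ≤ 𝔼 x, f x := by
  simp only [nbrAvg_eq_sum_div hG, Fintype.expect_eq_sum_div_card, ← Finset.sum_div,
    sum_sum_neighborFinset hG]
  gcongr
  rw [mul_div_right_comm]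
  exact mul_le_of_le_one_left (Finset.sum_nonneg fun x _ => hf x) (div_self_le_one _)

theorem sum_sum_offDiag_neighborFinset_le
    (hk : ∀ y z, y ≠ z → (G.commonNeighbors y z).ncard ≤ k) {F : V → ℝ} (hF : ∀ x, 0 ≤ F x) :
    ∑ x, ∑ p ∈ (G.neighborFinset x).offDiag, F p.1 * F p.2 ≤ k * (∑ x, F x) ^ 2 := by
  classical
  have hF₂ (p : V × V) : 0 ≤ F p.1 * F p.2 := mul_nonneg (hF _) (hF _)
  calc ∑ x, ∑ p ∈ (G.neighborFinset x).offDiag, F p.1 * F p.2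
      = ∑ p ∈ Finset.univ.offDiag, ∑ _x ∈ (G.commonNeighbors p.1 p.2).toFinset, F p.1 * F p.2 :=
        Finset.sum_comm' (by
          simp [SimpleGraph.mem_commonNeighbors, G.adj_comm, and_comm, and_left_comm])
    _ ≤ ∑ p ∈ Finset.univ.offDiag, k * (F p.1 * F p.2) := by
        refine Finset.sum_le_sum fun p hp => ?_
        rw [Finset.sum_const, nsmul_eq_mul, ← Set.ncard_eq_toFinset_card']
        have := hF₂ p
        gcongr
        exact hk _ _ (Finset.mem_offDiag.1 hp).2.2
    _ ≤ k * (∑ x, F x) ^ 2 := by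
        rw [← Finset.mul_sum, sum_offDiag_mul]
        gcongr
        exact sub_le_self _ (Finset.sum_nonneg fun x _ => sq_nonneg _)

theorem sum_sum_neighborFinset_rpow_two_thirds_pow_three_le (hG : G.IsRegularOfDegree m)
    (hk : ∀ y z, y ≠ z → (G.commonNeighbors y z).ncard ≤ k) {F : V → ℝ} (hF : ∀ x, 0 ≤ F x) :
    ∑ x, (∑ y ∈ G.neighborFinset x, F y ^ (2 / 3 : ℝ)) ^ 3 ≤
      4 * (k + 1) * m * (∑ x, F x) ^ 2 := by
  calc ∑ x, (∑ y ∈ G.neighborFinset x, F y ^ (2 / 3 : ℝ)) ^ 3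
      ≤ ∑ x, 4 * (∑ y ∈ G.neighborFinset x, F y ^ 2 +
          m * ∑ p ∈ (G.neighborFinset x).offDiag, F p.1 * F p.2) := by
        gcongr with x
        rw [← hG.degree_eq x, ← G.card_neighborFinset_eq_degree]
        exact sum_rpow_two_thirds_pow_three_le_offDiag _ hF
    _ = 4 * (m * ∑ x, F x ^ 2 +
          m * ∑ x, ∑ p ∈ (G.neighborFinset x).offDiag, F p.1 * F p.2) := by
        rw [← Finset.mul_sum, Finset.sum_add_distrib, sum_sum_neighborFinset hG,
          ← Finset.mul_sum]
    _ ≤ 4 * (m * (∑ x, F x) ^ 2 + m * (k * (∑ x, F x) ^ 2)) := by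
        gcongr
        · exact Finset.sum_sq_le_sq_sum_of_nonneg fun x _ => hF x
        · exact sum_sum_offDiag_neighborFinset_le hk hF
    _ = 4 * (k + 1) * m * (∑ x, F x) ^ 2 := by ring

theorem expect_nbrAvg_rpow_two_thirds_pow_three_le (hG : G.IsRegularOfDegree m)
    (hk : ∀ y z, y ≠ z → (G.commonNeighbors y z).ncard ≤ k) {c : ℝ}
    (hcard : Fintype.card V ≤ c * m ^ 2) {F : V → ℝ} (hF : ∀ x, 0 ≤ F x) :
    𝔼 x, nbrAvg G (fun y => F y ^ (2 / 3 : ℝ)) x ^ 3 ≤ 4 * (k + 1) * c * (𝔼 x, F x) ^ 2 := by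
  cases isEmpty_or_nonempty V
  · simp
  have hn : (0 : ℝ) < Fintype.card V := by exact_mod_cast Fintype.card_pos
  have hm : (m : ℝ) ≠ 0 := by
    rintro h
    simp only [h] at hcard
    linarith
  simp only [nbrAvg_eq_sum_div hG, div_pow, Fintype.expect_eq_sum_div_card, ← Finset.sum_div]
  calc (∑ x, (∑ y ∈ G.neighborFinset x, F y ^ (2 / 3 : ℝ)) ^ 3) / (m : ℝ) ^ 3 / Fintype.card V
      ≤ 4 * (k + 1) * m * (∑ x, F x) ^ 2 / (m : ℝ) ^ 3 / Fintype.card V := by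
        gcongr
        exact sum_sum_neighborFinset_rpow_two_thirds_pow_three_le hG hk hF
    _ = 4 * (k + 1) * (Fintype.card V / (m : ℝ) ^ 2) *
          ((∑ x, F x) ^ 2 / (Fintype.card V : ℝ) ^ 2) := by field_simp
    _ ≤ 4 * (k + 1) * c * ((∑ x, F x) ^ 2 / (Fintype.card V : ℝ) ^ 2) := by
        gcongr
        exact (div_le_iff₀ (by positivity)).2 hcard

theorem nbrAvg_rpow_le {F : V → ℝ} (hF : ∀ x, 0 ≤ F x) {a : ℝ} (ha₀ : 0 ≤ a) (ha : a ≤ 2 / 3)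
    (x : V) : nbrAvg G (fun y => F y ^ a) x ≤
      (nbrAvg G (fun y => F y ^ (2 / 3 : ℝ)) x ^ 3) ^ (a / 2) := by
  have hF' (y : V) : 0 ≤ F y ^ (2 / 3 : ℝ) := Real.rpow_nonneg (hF y) _
  calc nbrAvg G (fun y => F y ^ a) x
      = nbrAvg G (fun y => (F y ^ (2 / 3 : ℝ)) ^ (3 * a / 2)) x := by
        congr! 2 with y
        rw [← Real.rpow_mul (hF y)]
        ring_nf
    _ ≤ nbrAvg G (fun y => F y ^ (2 / 3 : ℝ)) x ^ (3 * a / 2) :=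
        expect_rpow_le hF' (by positivity) (by linarith)
    _ = (nbrAvg G (fun y => F y ^ (2 / 3 : ℝ)) x ^ 3) ^ (a / 2) := by
        rw [← Real.rpow_natCast_mul (nbrAvg_nonneg hF' x)]
        congr 1
        push_cast
        ring

end NeighborAverage

/-! ### Multilinear estimates for stars -/

theorem rpow_mul_add_mul {y u v a b : ℝ} (hy : 0 ≤ y) (hu : 0 ≤ u) (hv : 0 ≤ v) (ha : 0 ≤ a)
    (hb : 0 ≤ b) : y ^ (a * u + b * v) = (y ^ u) ^ a * (y ^ v) ^ b := by
  rw [Real.rpow_add_of_nonneg hy (mul_nonneg ha hu) (mul_nonneg hb hv), mul_comm a, mul_comm b,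
    Real.rpow_mul hy, Real.rpow_mul hy]

theorem mul_prod_rpow_mul_mul_prod_rpow {ι : Type*} [Fintype ι] {y z : ℝ} {Y Z : ι → ℝ}
    (hy : 0 ≤ y) (hz : 0 ≤ z) (hY : ∀ i, 0 ≤ Y i) (hZ : ∀ i, 0 ≤ Z i) (a b : ℝ) :
    (y * ∏ i, Y i) ^ a * (z * ∏ i, Z i) ^ b = y ^ a * z ^ b * ∏ i, Y i ^ a * Z i ^ b := by
  rw [Real.mul_rpow hy (Finset.prod_nonneg fun i _ => hY i),
    Real.mul_rpow hz (Finset.prod_nonneg fun i _ => hZ i),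
    ← Real.finsetProd_rpow _ _ fun i _ => hY i, ← Real.finsetProd_rpow _ _ fun i _ => hZ i,
    mul_mul_mul_comm, Finset.prod_mul_distrib]

theorem prod_mul_sq_rpow_half_le {ι : Type*} [Fintype ι] {K : ℝ} (hK : 1 ≤ K) {y a : ι → ℝ}
    (hy : ∀ i, 0 ≤ y i) (ha : ∀ i, 0 ≤ a i) (hsum : ∑ i, a i ≤ 2) :
    ∏ i, (K * y i ^ 2) ^ (a i / 2) ≤ K * ∏ i, y i ^ a i := by
  have hK₀ : 0 ≤ K := zero_le_one.trans hK
  have hsum' : ∑ i, a i / 2 ≤ 1 := by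
    rw [← Finset.sum_div]
    linarith
  calc ∏ i, (K * y i ^ 2) ^ (a i / 2)
      = ∏ i, K ^ (a i / 2) * y i ^ a i := by
        refine Finset.prod_congr rfl fun i _ => ?_
        rw [Real.mul_rpow hK₀ (sq_nonneg _), ← Real.rpow_natCast_mul (hy i), Nat.cast_ofNat,
          mul_div_cancel₀ _ two_ne_zero]
    _ = K ^ (∑ i, a i / 2) * ∏ i, y i ^ a i := by
        rw [Finset.prod_mul_distrib,
          Real.rpow_sum_of_nonneg hK₀ fun i _ => div_nonneg (ha i) zero_le_two]
    _ ≤ K * ∏ i, y i ^ a i :=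
        mul_le_mul_of_nonneg_right
          ((Real.rpow_le_rpow_of_exponent_le hK hsum').trans_eq (Real.rpow_one K))
          (Finset.prod_nonneg fun i _ => Real.rpow_nonneg (hy i) _)

section Star

variable {V ι : Type*} [Fintype V] [Fintype ι] {G : SimpleGraph V} [DecidableRel G.Adj] {m : ℕ}
  {K : ℝ}

variable (G) in
/-- The normalized multilinear form of a star with leaves `ι` on the graph `G`: the average of
`e x * ∏ i, f i (y i)` over the homomorphisms from the star to `G`, where `x` is the image of the
centre and `y i` that of the leaf `i`. -/
def starAverage (e : V → ℝ) (f : ι → V → ℝ) : ℝ := 𝔼 x, e x * ∏ i, nbrAvg G (f i) x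

variable (G ι K) in
/-- The exponents `(c, a)`, reciprocals of Lebesgue exponents at the centre and at the leaves, for
which the star satisfies the normalized `L^{1/c} × ∏ L^{1/a i}` bound with constant `K`. The bound
is tested on powers of functions, which avoids norms and the exponent `∞`. -/
def starRegion : Set (ℝ × (ι → ℝ)) :=
  {z | 0 ≤ z ∧ ∀ (E : V → ℝ) (F : ι → V → ℝ), (∀ x, 0 ≤ E x) → (∀ i x, 0 ≤ F i x) →
    starAverage G (fun x => E x ^ z.1) (fun i x => F i x ^ z.2 i) ≤
      K * ((𝔼 x, E x) ^ z.1 * ∏ i, (𝔼 x, F i x) ^ z.2 i)}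

theorem starAverage_nonneg {e : V → ℝ} {f : ι → V → ℝ} (he : ∀ x, 0 ≤ e x)
    (hf : ∀ i x, 0 ≤ f i x) : 0 ≤ starAverage G e f :=
  Finset.expect_nonneg fun x _ =>
    mul_nonneg (he x) (Finset.prod_nonneg fun i _ => nbrAvg_nonneg (hf i) x)

theorem nbrAvg_rpow_mul_rpow_le {F : V → ℝ} (hF : ∀ x, 0 ≤ F x) {u v a b : ℝ} (hu : 0 ≤ u)
    (hv : 0 ≤ v) (ha : 0 ≤ a) (hb : 0 ≤ b) (hab : a + b = 1) (x : V) :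
    nbrAvg G (fun y => F y ^ (a * u + b * v)) x ≤
      nbrAvg G (fun y => F y ^ u) x ^ a * nbrAvg G (fun y => F y ^ v) x ^ b := by
  simp only [nbrAvg, rpow_mul_add_mul (hF _) hu hv ha hb]
  exact expect_rpow_mul_rpow_le (fun y => Real.rpow_nonneg (hF y) _)
    (fun y => Real.rpow_nonneg (hF y) _) ha hb hab

theorem starAverage_rpow_mul_add_mul_le {c c' : ℝ} {a a' : ι → ℝ} (hc : 0 ≤ c) (hc' : 0 ≤ c')
    (ha : 0 ≤ a) (ha' : 0 ≤ a') {s t : ℝ} (hs : 0 ≤ s) (ht : 0 ≤ t) (hst : s + t = 1)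
    {E : V → ℝ} {F : ι → V → ℝ} (hE : ∀ x, 0 ≤ E x) (hF : ∀ i x, 0 ≤ F i x) :
    starAverage G (fun x => E x ^ (s * c + t * c')) (fun i x => F i x ^ (s * a i + t * a' i)) ≤
      starAverage G (fun x => E x ^ c) (fun i x => F i x ^ a i) ^ s *
        starAverage G (fun x => E x ^ c') (fun i x => F i x ^ a' i) ^ t := by
  have hE' (r : ℝ) (x : V) : 0 ≤ E x ^ r := Real.rpow_nonneg (hE x) r
  have hF' (r : ℝ) (i : ι) (x : V) : 0 ≤ nbrAvg G (fun y => F i y ^ r) x :=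
    nbrAvg_nonneg (fun y => Real.rpow_nonneg (hF i y) r) x
  refine le_trans (Finset.expect_le_expect fun x _ => ?_) (expect_rpow_mul_rpow_le
    (fun x => mul_nonneg (hE' _ x) (Finset.prod_nonneg fun i _ => hF' _ i x))
    (fun x => mul_nonneg (hE' _ x) (Finset.prod_nonneg fun i _ => hF' _ i x)) hs ht hst)
  rw [mul_prod_rpow_mul_mul_prod_rpow (hE' _ x) (hE' _ x) (fun i => hF' _ i x) (fun i => hF' _ i x),
    ← rpow_mul_add_mul (hE x) hc hc' hs ht]
  exact mul_le_mul_of_nonneg_left (Finset.prod_le_prod (fun i _ => hF' _ i x)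
    fun i _ => nbrAvg_rpow_mul_rpow_le (hF i) (ha i) (ha' i) hs ht hst x) (hE' _ x)

theorem convex_starRegion (hK : 0 ≤ K) : Convex ℝ (starRegion ι G K) := by
  rintro ⟨c, a⟩ ⟨hz, hbound⟩ ⟨c', a'⟩ ⟨hz', hbound'⟩ s t hs ht hst
  refine ⟨add_nonneg (smul_nonneg hs hz) (smul_nonneg ht hz'), fun E F hE hF => ?_⟩
  have hE' : 0 ≤ 𝔼 x, E x := Finset.expect_nonneg fun x _ => hE x
  have hF' (i : ι) : 0 ≤ 𝔼 x, F i x := Finset.expect_nonneg fun x _ => hF i x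
  have hEpow (u : ℝ) : 0 ≤ (𝔼 x, E x) ^ u := Real.rpow_nonneg hE' u
  have hFpow (i : ι) (u : ℝ) : 0 ≤ (𝔼 x, F i x) ^ u := Real.rpow_nonneg (hF' i) u
  have hstar (u : ℝ) (w : ι → ℝ) : 0 ≤ starAverage G (fun x => E x ^ u) (fun i x => F i x ^ w i) :=
    starAverage_nonneg (fun x => Real.rpow_nonneg (hE x) u) fun i x => Real.rpow_nonneg (hF i x) _
  have hnorms (u : ℝ) (w : ι → ℝ) : 0 ≤ (𝔼 x, E x) ^ u * ∏ i, (𝔼 x, F i x) ^ w i :=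
    mul_nonneg (hEpow u) (Finset.prod_nonneg fun i _ => hFpow i _)
  calc starAverage G (fun x => E x ^ (s * c + t * c')) (fun i x => F i x ^ (s * a i + t * a' i))
      ≤ starAverage G (fun x => E x ^ c) (fun i x => F i x ^ a i) ^ s *
          starAverage G (fun x => E x ^ c') (fun i x => F i x ^ a' i) ^ t :=
        starAverage_rpow_mul_add_mul_le hz.1 hz'.1 hz.2 hz'.2 hs ht hst hE hF
    _ ≤ (K * ((𝔼 x, E x) ^ c * ∏ i, (𝔼 x, F i x) ^ a i)) ^ s *
          (K * ((𝔼 x, E x) ^ c' * ∏ i, (𝔼 x, F i x) ^ a' i)) ^ t :=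
        mul_le_mul (Real.rpow_le_rpow (hstar _ _) (hbound E F hE hF) hs)
          (Real.rpow_le_rpow (hstar _ _) (hbound' E F hE hF) ht) (Real.rpow_nonneg (hstar _ _) t)
          (Real.rpow_nonneg (mul_nonneg hK (hnorms _ _)) s)
    _ = K * ((𝔼 x, E x) ^ (s * c + t * c') * ∏ i, (𝔼 x, F i x) ^ (s * a i + t * a' i)) := by
        rw [Real.mul_rpow hK (hnorms _ _), Real.mul_rpow hK (hnorms _ _), mul_mul_mul_comm,
          ← Real.rpow_add_of_nonneg hK hs ht, hst, Real.rpow_one,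
          mul_prod_rpow_mul_mul_prod_rpow (hEpow c) (hEpow c') (fun i => hFpow i _)
            fun i => hFpow i _, rpow_mul_add_mul hE' hz.1 hz'.1 hs ht]
        congr! 3 with i
        exact (rpow_mul_add_mul (hF' i) (hz.2 i) (hz'.2 i) hs ht).symm

theorem single_mem_starRegion [DecidableEq ι] (hG : G.IsRegularOfDegree m) (hK : 1 ≤ K) (j : ι) :
    ((0, Pi.single j 1) : ℝ × (ι → ℝ)) ∈ starRegion ι G K := by
  refine ⟨⟨le_rfl, Pi.single_nonneg.2 zero_le_one⟩, fun E F _ hF => ?_⟩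
  have hF' : 0 ≤ 𝔼 x, F j x := Finset.expect_nonneg fun x _ => hF j x
  have hprod : ∏ i, (𝔼 x, F i x) ^ (Pi.single j 1 : ι → ℝ) i = 𝔼 x, F j x := by
    rw [Fintype.prod_eq_single j fun i hi => by simp [hi]]
    simp
  have hconst (i : ι) (hi : i ≠ j) (x : V) :
      nbrAvg G (fun y => F i y ^ (Pi.single j 1 : ι → ℝ) i) x ≤ 1 := by
    simp only [Pi.single_eq_of_ne hi, Real.rpow_zero, nbrAvg, Finset.expect_eq_sum_div_card,
      Finset.sum_const, nsmul_eq_mul, mul_one]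
    exact div_self_le_one _
  calc starAverage G (fun x => E x ^ (0 : ℝ)) (fun i x => F i x ^ (Pi.single j 1 : ι → ℝ) i)
      ≤ 𝔼 x, nbrAvg G (F j) x := by
        refine Finset.expect_le_expect fun x _ => ?_
        beta_reduce
        rw [Real.rpow_zero, one_mul, ← Finset.mul_prod_erase _ _ (Finset.mem_univ j)]
        simp only [Pi.single_eq_same, Real.rpow_one]
        refine mul_le_of_le_one_right (nbrAvg_nonneg (hF j) x) (Finset.prod_le_one
          (fun i _ => nbrAvg_nonneg (fun y => Real.rpow_nonneg (hF i y) _) x)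
          fun i hi => hconst i (Finset.ne_of_mem_erase hi) x)
    _ ≤ 𝔼 x, F j x := expect_nbrAvg_le hG (hF j)
    _ ≤ K * ((𝔼 x, E x) ^ (0 : ℝ) * ∏ i, (𝔼 x, F i x) ^ (Pi.single j 1 : ι → ℝ) i) := by
        rw [hprod, Real.rpow_zero, one_mul]
        exact le_mul_of_one_le_left hF' hK

theorem mem_starRegion_of_le_two_thirds (hK : 1 ≤ K)
    (hnbr : ∀ F : V → ℝ, (∀ x, 0 ≤ F x) →
      𝔼 x, nbrAvg G (fun y => F y ^ (2 / 3 : ℝ)) x ^ 3 ≤ K * (𝔼 x, F x) ^ 2)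
    {c : ℝ} {a : ι → ℝ} (hc : 0 ≤ c) (ha : 0 ≤ a) (ha' : ∀ i, a i ≤ 2 / 3)
    (hca : 2 * c + ∑ i, a i ≤ 2) : (c, a) ∈ starRegion ι G K := by
  refine ⟨⟨hc, ha⟩, fun E F hE hF => ?_⟩
  have hF' (i : ι) : 0 ≤ 𝔼 x, F i x := Finset.expect_nonneg fun x _ => hF i x
  have hEpow : 0 ≤ (𝔼 x, E x) ^ c := Real.rpow_nonneg (Finset.expect_nonneg fun x _ => hE x) c
  have ha₂ (i : ι) : 0 ≤ a i / 2 := div_nonneg (ha i) zero_le_two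
  set T : ι → V → ℝ := fun i x => nbrAvg G (fun y => F i y ^ (2 / 3 : ℝ)) x ^ 3
  have hT (i : ι) (x : V) : 0 ≤ T i x :=
    pow_nonneg (nbrAvg_nonneg (fun y => Real.rpow_nonneg (hF i y) _) x) 3
  have hT' (i : ι) : 0 ≤ 𝔼 x, T i x := Finset.expect_nonneg fun x _ => hT i x
  calc starAverage G (fun x => E x ^ c) (fun i x => F i x ^ a i)
      ≤ 𝔼 x, E x ^ c * ∏ i, T i x ^ (a i / 2) := by
        refine Finset.expect_le_expect fun x _ => mul_le_mul_of_nonneg_left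
          (Finset.prod_le_prod (fun i _ => ?_) fun i _ => ?_) (Real.rpow_nonneg (hE x) c)
        · exact nbrAvg_nonneg (fun y => Real.rpow_nonneg (hF i y) _) x
        · exact nbrAvg_rpow_le (hF i) (ha i) (ha' i) x
    _ ≤ (𝔼 x, E x) ^ c * ∏ i, (𝔼 x, T i x) ^ (a i / 2) :=
        expect_rpow_mul_prod_rpow_le hE hT hc ha₂ (by rw [← Finset.sum_div]; linarith)
    _ ≤ (𝔼 x, E x) ^ c * ∏ i, (K * (𝔼 x, F i x) ^ 2) ^ (a i / 2) := by
        refine mul_le_mul_of_nonneg_left (Finset.prod_le_prod (fun i _ => ?_) fun i _ => ?_) hEpow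
        · exact Real.rpow_nonneg (hT' i) _
        · exact Real.rpow_le_rpow (hT' i) (hnbr (F i) (hF i)) (ha₂ i)
    _ ≤ (𝔼 x, E x) ^ c * (K * ∏ i, (𝔼 x, F i x) ^ a i) :=
        mul_le_mul_of_nonneg_left (prod_mul_sq_rpow_half_le hK hF' ha (by linarith)) hEpow
    _ = K * ((𝔼 x, E x) ^ c * ∏ i, (𝔼 x, F i x) ^ a i) := mul_left_comm ..

theorem update_two_thirds_mem_starRegion [DecidableEq ι] (hK : 1 ≤ K)
    (hnbr : ∀ F : V → ℝ, (∀ x, 0 ≤ F x) →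
      𝔼 x, nbrAvg G (fun y => F y ^ (2 / 3 : ℝ)) x ^ 3 ≤ K * (𝔼 x, F x) ^ 2)
    {c : ℝ} {a : ι → ℝ} (hc : 0 ≤ c) (ha : 0 ≤ a) {j : ι}
    (hca : c + ∑ i ∈ Finset.univ.erase j, a i ≤ 2 / 3) :
    (c, Function.update a j (2 / 3)) ∈ starRegion ι G K := by
  have hsum : 0 ≤ ∑ i ∈ Finset.univ.erase j, a i := Finset.sum_nonneg fun i _ => ha i
  refine mem_starRegion_of_le_two_thirds hK hnbr hc
    (le_update_iff.2 ⟨by norm_num, fun i _ => ha i⟩) (fun i => ?_) ?_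
  · obtain rfl | hi := eq_or_ne i j
    · simp
    · have := Finset.single_le_sum (fun i _ => ha i) (Finset.mem_erase.2 ⟨hi, Finset.mem_univ i⟩)
      rw [Function.update_of_ne hi]
      linarith
  · rw [Finset.sum_update_of_mem (Finset.mem_univ j), Finset.sdiff_singleton_eq_erase]
    linarith

-- An exponent `a j > 2/3` makes `(c, a)` a convex combination of the trivial point `(0, e_j)` and
-- of a point whose `j`-th exponent is `2/3`.
theorem mem_starRegion (hG : G.IsRegularOfDegree m) (hK : 1 ≤ K)
    (hnbr : ∀ F : V → ℝ, (∀ x, 0 ≤ F x) →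
      𝔼 x, nbrAvg G (fun y => F y ^ (2 / 3 : ℝ)) x ^ 3 ≤ K * (𝔼 x, F x) ^ 2)
    {c : ℝ} {a : ι → ℝ} (hc : 0 ≤ c) (ha : 0 ≤ a) (hca : 2 * c + ∑ i, a i ≤ 2)
    (haj : ∀ j, c + ∑ i, a i + a j ≤ 2) : (c, a) ∈ starRegion ι G K := by
  classical
  by_cases! hsmall : ∀ i, a i ≤ 2 / 3
  · exact mem_starRegion_of_le_two_thirds hK hnbr hc ha hsmall hca
  obtain ⟨j, hj⟩ := hsmall
  set S := ∑ i ∈ Finset.univ.erase j, a i with hS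
  have hS₀ : 0 ≤ S := Finset.sum_nonneg fun i _ => ha i
  have hcS : c + S ≤ 2 * (1 - a j) := by
    have := haj j
    rw [← Finset.add_sum_erase _ _ (Finset.mem_univ j)] at this
    linarith
  set r := 3 * (1 - a j) with hr
  have hr₀ : 0 ≤ r := by linarith
  have hrescaled : (c / r, Function.update (fun i => a i / r) j (2 / 3)) ∈ starRegion ι G K := by
    refine update_two_thirds_mem_starRegion hK hnbr (div_nonneg hc hr₀)
      (fun i => div_nonneg (ha i) hr₀) ?_
    rw [← Finset.sum_div, ← hS, ← add_div]
    exact div_le_of_le_mul₀ hr₀ (by norm_num) (by linarith)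
  have hcombination : (c, a) = (1 - r) • ((0, Pi.single j 1) : ℝ × (ι → ℝ)) +
      r • (c / r, Function.update (fun i => a i / r) j (2 / 3)) := by
    ext i
    · simp [mul_div_cancel_of_imp' fun h : r = 0 => (by linarith : c = 0)]
    · obtain rfl | hi := eq_or_ne i j
      · simp only [Prod.snd_add, Prod.smul_snd, Pi.add_apply, Pi.smul_apply, Pi.single_eq_same,
          Function.update_self, smul_eq_mul]
        linarith
      · have hai : a i ≤ S :=
          Finset.single_le_sum (fun i _ => ha i) (Finset.mem_erase.2 ⟨hi, Finset.mem_univ i⟩)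
        simp [hi, mul_div_cancel_of_imp' fun h : r = 0 =>
          (le_antisymm (by linarith) (ha i) : a i = 0)]
  rw [hcombination]
  exact convex_starRegion (zero_le_one.trans hK) (single_mem_starRegion hG hK j) hrescaled
    (by linarith) hr₀ (by ring)

end Star

section NormLp

variable {α : Type*} [Fintype α] {p : ℝ≥0∞}

theorem inv_toReal_le_one (hp : 1 ≤ p) : p.toReal⁻¹ ≤ 1 := by
  obtain rfl | h := eq_or_ne p ∞
  · simp
  · exact inv_le_one_of_one_le₀ (by simpa using ENNReal.toReal_mono h hp)

theorem normLp_nonneg (p : ℝ≥0∞) (f : α → ℝ) : 0 ≤ normLp p f := by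
  rw [normLp]
  split_ifs
  · exact Real.iSup_nonneg fun x => abs_nonneg _
  · positivity

theorem normLp_indicator_one_le (hp : p ≠ 0) (E : Set α) :
    normLp p (E.indicator 1) ≤ (E.ncard / Fintype.card α : ℝ) ^ p.toReal⁻¹ := by
  classical
  rw [normLp]
  split_ifs with h
  · simp only [h, ENNReal.toReal_top, inv_zero, Real.rpow_zero]
    refine Real.iSup_le (fun x => ?_) zero_le_one
    by_cases hx : x ∈ E <;> simp [hx]
  · have hp₀ : p.toReal ≠ 0 := ENNReal.toReal_ne_zero.2 ⟨hp, h⟩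
    have hpow (x : α) : |E.indicator (1 : α → ℝ) x| ^ p.toReal = if x ∈ E then 1 else 0 := by
      by_cases hx : x ∈ E <;> simp [hx, hp₀]
    simp [hpow, Set.ncard_eq_toFinset_card', Set.toFinset, div_eq_inv_mul]

theorem normLp_indicator_one_le_two_div (hp : 1 ≤ p) {E : Set α} {D : ℝ} (hD : 0 ≤ D)
    (hE : (E.ncard / Fintype.card α : ℝ) ≤ 2 / D) :
    normLp p (E.indicator 1) ≤ 2 / D ^ p.toReal⁻¹ := calc
  normLp p (E.indicator 1) ≤ (E.ncard / Fintype.card α : ℝ) ^ p.toReal⁻¹ :=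
      normLp_indicator_one_le (zero_lt_one.trans_le hp).ne' E
  _ ≤ (2 / D) ^ p.toReal⁻¹ := by gcongr
  _ = 2 ^ p.toReal⁻¹ / D ^ p.toReal⁻¹ := Real.div_rpow zero_le_two hD _
  _ ≤ 2 / D ^ p.toReal⁻¹ := by
      gcongr
      exact (Real.rpow_le_rpow_of_exponent_le one_le_two (inv_toReal_le_one hp)).trans_eq
        (Real.rpow_one 2)

theorem normLp_top_le_card_mul (hp : 1 ≤ p) (f : α → ℝ) :
    normLp ∞ f ≤ Fintype.card α * normLp p f := by
  cases isEmpty_or_nonempty α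
  · simp [normLp]
  have hcard : (1 : ℝ) ≤ Fintype.card α := by exact_mod_cast Fintype.card_pos (α := α)
  obtain rfl | h := eq_or_ne p ∞
  · exact le_mul_of_one_le_left (normLp_nonneg _ _) hcard
  have hp₀ : p.toReal ≠ 0 := ENNReal.toReal_ne_zero.2 ⟨(zero_lt_one.trans_le hp).ne', h⟩
  have hnonneg (x : α) : 0 ≤ |f x| ^ p.toReal := Real.rpow_nonneg (abs_nonneg _) _
  rw [normLp, if_pos rfl, normLp, if_neg h, one_div]
  refine ciSup_le fun x => ?_
  calc |f x| = (|f x| ^ p.toReal) ^ p.toReal⁻¹ := (Real.rpow_rpow_inv (abs_nonneg _) hp₀).symm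
    _ ≤ (Fintype.card α * ((Fintype.card α : ℝ)⁻¹ * ∑ y, |f y| ^ p.toReal)) ^ p.toReal⁻¹ := by
        rw [mul_inv_cancel_left₀ (by positivity)]
        gcongr
        exact Finset.single_le_sum (fun y _ => hnonneg y) (Finset.mem_univ x)
    _ = (Fintype.card α : ℝ) ^ p.toReal⁻¹ *
          ((Fintype.card α : ℝ)⁻¹ * ∑ y, |f y| ^ p.toReal) ^ p.toReal⁻¹ :=
        Real.mul_rpow (by positivity) (by positivity)
    _ ≤ Fintype.card α * ((Fintype.card α : ℝ)⁻¹ * ∑ y, |f y| ^ p.toReal) ^ p.toReal⁻¹ := by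
        gcongr
        exact (Real.rpow_le_rpow_of_exponent_le hcard (inv_toReal_le_one hp)).trans_eq
          (Real.rpow_one _)

theorem exists_le_mul_rpow_of_normLp (hp : p ≠ 0) [Nonempty α] {f : α → ℝ} (hf : ∀ x, 0 ≤ f x) :
    ∃ (κ : ℝ) (g : α → ℝ), 0 ≤ κ ∧ (∀ x, 0 ≤ g x) ∧ (∀ x, f x ≤ κ * g x ^ p.toReal⁻¹) ∧
      κ * (𝔼 x, g x) ^ p.toReal⁻¹ = normLp p f := by
  obtain rfl | h := eq_or_ne p ∞
  · refine ⟨⨆ x, |f x|, 1, Real.iSup_nonneg fun x => abs_nonneg _, fun _ => zero_le_one,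
      fun x => ?_, by simp [normLp]⟩
    simp only [ENNReal.toReal_top, inv_zero, Real.rpow_zero, mul_one]
    exact (le_abs_self _).trans (le_ciSup (f := fun x => |f x|) (Set.finite_range _).bddAbove x)
  · refine ⟨1, fun x => f x ^ p.toReal, zero_le_one, fun x => Real.rpow_nonneg (hf x) _,
      fun x => ?_, ?_⟩
    · rw [one_mul, Real.rpow_rpow_inv (hf x) (ENNReal.toReal_ne_zero.2 ⟨hp, h⟩)]
    · simp [normLp, h, Fintype.expect_eq_sum_div_card, div_eq_inv_mul, abs_of_nonneg (hf _)]

end NormLp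

section StarNorm

variable {V ι : Type*} [Fintype V] [Fintype ι] {G : SimpleGraph V} [DecidableRel G.Adj] {K : ℝ}

theorem nbrAvg_const_mul (κ : ℝ) (f : V → ℝ) (x : V) :
    nbrAvg G (fun y => κ * f y) x = κ * nbrAvg G f x :=
  (Finset.mul_expect _ _ _).symm

theorem nbrAvg_mono {f g : V → ℝ} (hfg : ∀ x, f x ≤ g x) (x : V) : nbrAvg G f x ≤ nbrAvg G g x :=
  Finset.expect_le_expect fun y _ => hfg y

theorem starAverage_mono {e e' : V → ℝ} {f f' : ι → V → ℝ} (he : ∀ x, 0 ≤ e x)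
    (hf : ∀ i x, 0 ≤ f i x) (hee' : ∀ x, e x ≤ e' x) (hff' : ∀ i x, f i x ≤ f' i x) :
    starAverage G e f ≤ starAverage G e' f' :=
  Finset.expect_le_expect fun x _ => mul_le_mul (hee' x)
    (Finset.prod_le_prod (fun i _ => nbrAvg_nonneg (hf i) x) fun i _ => nbrAvg_mono (hff' i) x)
    (Finset.prod_nonneg fun i _ => nbrAvg_nonneg (hf i) x) ((he x).trans (hee' x))

theorem starAverage_const_mul (κ : ℝ) (μ : ι → ℝ) (e : V → ℝ) (f : ι → V → ℝ) :
    starAverage G (fun x => κ * e x) (fun i x => μ i * f i x) =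
      κ * (∏ i, μ i) * starAverage G e f := by
  simp only [starAverage, nbrAvg_const_mul, Finset.prod_mul_distrib, Finset.mul_expect,
    mul_mul_mul_comm]

theorem starAverage_le_mul_normLp [Nonempty V] {r : ℝ≥0∞} {p : ι → ℝ≥0∞} (hr : r ≠ 0)
    (hp : ∀ i, p i ≠ 0) (hmem : (r.toReal⁻¹, fun i => (p i).toReal⁻¹) ∈ starRegion ι G K)
    {e : V → ℝ} {f : ι → V → ℝ} (he : ∀ x, 0 ≤ e x) (hf : ∀ i x, 0 ≤ f i x) :
    starAverage G e f ≤ K * (normLp r e * ∏ i, normLp (p i) (f i)) := by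
  obtain ⟨κ, E, hκ, hE, heE, hnorm_e⟩ := exists_le_mul_rpow_of_normLp hr he
  choose μ g hμ hg hfg hnorm_f using fun i => exists_le_mul_rpow_of_normLp (hp i) (hf i)
  calc starAverage G e f
      ≤ κ * (∏ i, μ i) * starAverage G (fun x => E x ^ r.toReal⁻¹)
          (fun i x => g i x ^ (p i).toReal⁻¹) := by
        rw [← starAverage_const_mul]
        exact starAverage_mono he hf heE hfg
    _ ≤ κ * (∏ i, μ i) *
          (K * ((𝔼 x, E x) ^ r.toReal⁻¹ * ∏ i, (𝔼 x, g i x) ^ (p i).toReal⁻¹)) :=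
        mul_le_mul_of_nonneg_left (hmem.2 E g hE hg)
          (mul_nonneg hκ (Finset.prod_nonneg fun i _ => hμ i))
    _ = K * (normLp r e * ∏ i, normLp (p i) (f i)) := by
        simp only [← hnorm_e, ← hnorm_f, Finset.prod_mul_distrib]
        ring

end StarNorm

/-! ### Circles over finite fields -/

section Circle

variable {F : Type*} [Field F] {t : F}

theorem mem_circle {x : Fin 2 → F} : x ∈ circle t ↔ x 0 ^ 2 + x 1 ^ 2 = t := Iff.rfl

theorem sub_mem_circle_comm {x y : Fin 2 → F} : x - y ∈ circle t ↔ y - x ∈ circle t := by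
  simp only [mem_circle, Pi.sub_apply, sub_sq_comm (x _)]

theorem zero_notMem_circle (ht : t ≠ 0) : (0 : Fin 2 → F) ∉ circle t := by
  simpa [mem_circle] using ht.symm

theorem exists_eq_mul_of_orthogonal {w d : Fin 2 → F} (hd : d ≠ 0)
    (hwd : w 0 * d 0 + w 1 * d 1 = 0) : ∃ s, w 0 = -s * d 1 ∧ w 1 = s * d 0 := by
  by_cases h : d 0 = 0
  · have h₁ : d 1 ≠ 0 := fun h₁ => hd (funext (Fin.forall_fin_two.2 ⟨h, h₁⟩))
    have hw : w 1 = 0 := by simpa [h, h₁] using hwd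
    exact ⟨-(w 0 / d 1), by field_simp, by simp [hw, h]⟩
  · refine ⟨w 1 / d 0, ?_, by field_simp⟩
    field_simp
    linear_combination hwd

-- The vectors `2u - y - z` and `2v - y - z` are orthogonal to `y - z`, hence parallel, and have the
-- same length, so they agree up to sign.
theorem eq_or_eq_of_sub_mem_circle (h2 : (2 : F) ≠ 0) (ht : t ≠ 0) {y z u v : Fin 2 → F}
    (hyz : y ≠ z) (hyu : y - u ∈ circle t) (hzu : z - u ∈ circle t) (hyv : y - v ∈ circle t)
    (hzv : z - v ∈ circle t) : v = u ∨ v = y + z - u := by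
  simp only [mem_circle, Pi.sub_apply] at hyu hzu hyv hzv
  have hd : y - z ≠ 0 := sub_ne_zero.2 hyz
  obtain ⟨r, hr₀, hr₁⟩ := exists_eq_mul_of_orthogonal (w := u + u - y - z) hd (by
    simp only [Pi.sub_apply, Pi.add_apply]
    linear_combination hzu - hyu)
  obtain ⟨s, hs₀, hs₁⟩ := exists_eq_mul_of_orthogonal (w := v + v - y - z) hd (by
    simp only [Pi.sub_apply, Pi.add_apply]
    linear_combination hzv - hyv)
  simp only [Pi.sub_apply, Pi.add_apply] at hr₀ hr₁ hs₀ hs₁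
  set D := (y 0 - z 0) ^ 2 + (y 1 - z 1) ^ 2 with hD
  have hr : D * (r ^ 2 + 1) = 4 * t := by
    rw [hD]
    linear_combination 2 * hyu + 2 * hzu - (2 * u 0 - y 0 - z 0 - r * (y 1 - z 1)) * hr₀ -
      (2 * u 1 - y 1 - z 1 + r * (y 0 - z 0)) * hr₁
  have hs : D * (s ^ 2 + 1) = 4 * t := by
    rw [hD]
    linear_combination 2 * hyv + 2 * hzv - (2 * v 0 - y 0 - z 0 - s * (y 1 - z 1)) * hs₀ -
      (2 * v 1 - y 1 - z 1 + s * (y 0 - z 0)) * hs₁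
  have hD₀ : D ≠ 0 := by
    rintro h
    rw [h, zero_mul, show (4 : F) = 2 * 2 by norm_num] at hr
    exact mul_ne_zero (mul_ne_zero h2 h2) ht hr.symm
  have hsq : s ^ 2 = r ^ 2 := mul_left_cancel₀ hD₀ (by linear_combination hs - hr)
  obtain rfl | rfl := sq_eq_sq_iff_eq_or_eq_neg.1 hsq
  · left
    refine funext (Fin.forall_fin_two.2 ⟨mul_left_cancel₀ h2 ?_, mul_left_cancel₀ h2 ?_⟩)
    · linear_combination hs₀ - hr₀
    · linear_combination hs₁ - hr₁
  · right
    refine funext (Fin.forall_fin_two.2 ⟨mul_left_cancel₀ h2 ?_, mul_left_cancel₀ h2 ?_⟩) <;>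
      simp only [Pi.sub_apply, Pi.add_apply]
    · linear_combination hs₀ + hr₀
    · linear_combination hs₁ + hr₁

/-- The rotation by `π/3` about the origin, where `r` plays the role of `√3`. -/
def rotate (r : F) (x : Fin 2 → F) : Fin 2 → F :=
  ![(x 0 - r * x 1) / 2, (x 1 + r * x 0) / 2]

theorem rotate_mem_circle (h2 : (2 : F) ≠ 0) {r : F} (hr : 3 = r * r) {x : Fin 2 → F}
    (hx : x ∈ circle t) : rotate r x ∈ circle t := by
  rw [mem_circle] at hx ⊢
  simp only [rotate, Matrix.cons_val_zero, Matrix.cons_val_one]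
  field_simp
  linear_combination 4 * hx - (x 0 ^ 2 + x 1 ^ 2) * hr

theorem sub_rotate_mem_circle (h2 : (2 : F) ≠ 0) {r : F} (hr : 3 = r * r) {x : Fin 2 → F}
    (hx : x ∈ circle t) : x - rotate r x ∈ circle t := by
  rw [mem_circle] at hx ⊢
  simp only [rotate, Pi.sub_apply, Matrix.cons_val_zero, Matrix.cons_val_one]
  field_simp
  linear_combination 4 * hx - (x 0 ^ 2 + x 1 ^ 2) * hr

/-- The equilateral triangle with vertices at the origin, at `u` and at the image of `u` under the
rotation by `π/3`, where `r` plays the role of `√3`. -/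
def triangle (r : F) (u : Fin 2 → F) : Fin 3 → Fin 2 → F := ![0, u, rotate r u]

theorem triangle_sub_triangle_mem_circle (h2 : (2 : F) ≠ 0) {r : F} (hr : 3 = r * r)
    {u : Fin 2 → F} (hu : u ∈ circle t) {i j : Fin 3} (hij : i ≠ j) :
    triangle r u i - triangle r u j ∈ circle t := by
  wlog hlt : j < i generalizing i j
  · exact sub_mem_circle_comm.1 (this hij.symm (hij.lt_of_le (not_lt.1 hlt)))
  have h₁ := rotate_mem_circle h2 hr hu
  have h₂ := sub_mem_circle_comm.1 (sub_rotate_mem_circle h2 hr hu)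
  fin_cases i <;> fin_cases j <;> simp_all [triangle]

end Circle

section CircleFinite

variable {F : Type*} [Field F] [Finite F] {t : F}

theorem circle_nonempty (h2 : (2 : F) ≠ 0) (t : F) : (circle t).Nonempty := by
  have := Fintype.ofFinite F
  obtain ⟨a, b, hab⟩ := FiniteField.exists_root_sum_quadratic
    (Polynomial.degree_X_pow 2) (Polynomial.degree_X_pow_sub_C two_pos t)
    (FiniteField.odd_card_of_char_ne_two fun h => h2 <| by
      simpa [h] using CharP.cast_eq_zero F (ringChar F))
  refine ⟨![a, b], ?_⟩
  simp only [Polynomial.eval_sub, Polynomial.eval_pow, Polynomial.eval_X, Polynomial.eval_C] at hab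
  simp only [mem_circle, Matrix.cons_val_zero, Matrix.cons_val_one]
  linear_combination hab

theorem ncard_circle_pos (h2 : (2 : F) ≠ 0) (t : F) : 0 < (circle t).ncard :=
  (Set.ncard_pos (Set.toFinite _)).2 (circle_nonempty h2 t)

theorem ncard_circle_le_ncard_circle (h2 : (2 : F) ≠ 0) {s : F} (hs : s ≠ 0) (ht : t ≠ 0) :
    (circle s).ncard ≤ (circle t).ncard := by
  obtain ⟨z, hz⟩ := circle_nonempty h2 (t / s)
  rw [mem_circle, eq_div_iff hs] at hz
  have hz₀ : z 0 ^ 2 + z 1 ^ 2 ≠ 0 := left_ne_zero_of_mul (hz ▸ ht)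
  -- The injection is complex multiplication by `z`.
  refine Set.ncard_le_ncard_of_injOn
    (fun x => ![z 0 * x 0 - z 1 * x 1, z 0 * x 1 + z 1 * x 0]) (fun x hx => ?_)
    fun x _ y _ hxy => ?_
  · rw [mem_circle] at hx ⊢
    simp only [Matrix.cons_val_zero, Matrix.cons_val_one]
    linear_combination hz + (z 0 ^ 2 + z 1 ^ 2) * hx
  · have h₀ : z 0 * x 0 - z 1 * x 1 = z 0 * y 0 - z 1 * y 1 := congrFun hxy 0
    have h₁ : z 0 * x 1 + z 1 * x 0 = z 0 * y 1 + z 1 * y 0 := congrFun hxy 1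
    refine funext (Fin.forall_fin_two.2 ⟨mul_left_cancel₀ hz₀ ?_, mul_left_cancel₀ hz₀ ?_⟩)
    · linear_combination z 0 * h₀ + z 1 * h₁
    · linear_combination z 0 * h₁ - z 1 * h₀

end CircleFinite

section CircleCard

variable {F : Type*} [Field F] [Fintype F] {t : F}

theorem ncard_circle_eq_card_filter [DecidableEq F] (t : F) :
    (circle t).ncard = (Finset.univ.filter fun x : Fin 2 → F => x 0 ^ 2 + x 1 ^ 2 = t).card := by
  rw [← Set.ncard_coe_finset, Finset.coe_filter_univ]
  rfl

theorem ncard_circle_le (t : F) : (circle t).ncard ≤ 2 * Fintype.card F := by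
  classical
  rw [ncard_circle_eq_card_filter]
  refine Finset.card_le_mul_card_image_of_maps_to (f := fun x => x 0)
    (fun _ _ => Finset.mem_univ _) 2 fun a _ => ?_
  obtain hempty | ⟨z, hz⟩ := Finset.eq_empty_or_nonempty
    {x ∈ Finset.univ.filter fun x : Fin 2 → F => x 0 ^ 2 + x 1 ^ 2 = t | x 0 = a}
  · simp [hempty]
  refine (Finset.card_le_card fun x hx => ?_).trans
    (Finset.card_le_two (a := z) (b := ![z 0, -z 1]))
  simp only [Finset.mem_filter, Finset.mem_univ, true_and] at hx hz
  have h₀ : x 0 = z 0 := hx.2.trans hz.2.symm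
  obtain h₁ | h₁ : x 1 = z 1 ∨ x 1 = -z 1 := sq_eq_sq_iff_eq_or_eq_neg.1 (by
    linear_combination hx.1 - hz.1 - (x 0 + z 0) * h₀)
  · exact Finset.mem_insert.2 (.inl (funext (Fin.forall_fin_two.2 ⟨h₀, h₁⟩)))
  · exact Finset.mem_insert.2 (.inr (Finset.mem_singleton.2
      (funext (Fin.forall_fin_two.2 ⟨h₀, h₁⟩))))

theorem card_le_two_mul_ncard_circle (h2 : (2 : F) ≠ 0) (ht : t ≠ 0) :
    Fintype.card F ≤ 2 * (circle t).ncard := by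
  classical
  set q := Fintype.card F
  have hq : 2 < q := by
    rw [Fintype.two_lt_card_iff]
    exact ⟨0, 1, -1, by simp, by simp, fun h => h2 (by linear_combination h)⟩
  have htotal : q ^ 2 ≤ 2 * q + (q - 1) * (circle t).ncard := calc
    q ^ 2 = ∑ s : F, (circle s).ncard := by
        simp only [ncard_circle_eq_card_filter]
        rw [← Finset.card_eq_sum_card_fiberwise (s := Finset.univ) (t := Finset.univ)
          (f := fun x : Fin 2 → F => x 0 ^ 2 + x 1 ^ 2) fun _ _ => Finset.mem_univ _]
        simp [q]
    _ = (circle (0 : F)).ncard + ∑ s ∈ Finset.univ.erase (0 : F), (circle s).ncard :=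
        (Finset.add_sum_erase _ _ (Finset.mem_univ 0)).symm
    _ ≤ 2 * q + ∑ _s ∈ Finset.univ.erase (0 : F), (circle t).ncard :=
        add_le_add (ncard_circle_le 0) (Finset.sum_le_sum fun s hs =>
          ncard_circle_le_ncard_circle h2 (Finset.ne_of_mem_erase hs) ht)
    _ = 2 * q + (q - 1) * (circle t).ncard := by simp [q, Finset.card_erase_of_mem]
  zify [show 1 ≤ q by lia] at htotal hq ⊢
  nlinarith

end CircleCard

section CircleGraph

variable {F : Type*} [Field F] {t : F}

variable (t) in
/-- The graph on the plane whose edges join the points at distance `t`, that is, whose difference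
lies on the circle `S_t`. For `t = 0` the loops are removed. -/
def circleGraph : SimpleGraph (Fin 2 → F) := SimpleGraph.circulantGraph (circle t)

instance : DecidableRel (circleGraph t).Adj := Classical.decRel _

theorem circleGraph_adj (ht : t ≠ 0) {x y : Fin 2 → F} :
    (circleGraph t).Adj x y ↔ x - y ∈ circle t := by
  rw [circleGraph, SimpleGraph.circulantGraph_adj, sub_mem_circle_comm (x := y), or_self,
    and_iff_right_iff_imp]
  rintro h rfl
  exact zero_notMem_circle ht (sub_self x ▸ h)

theorem ncard_commonNeighbors_circleGraph_le (h2 : (2 : F) ≠ 0) (ht : t ≠ 0) {y z : Fin 2 → F}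
    (hyz : y ≠ z) : ((circleGraph t).commonNeighbors y z).ncard ≤ 2 := by
  obtain hempty | ⟨u, hu⟩ := ((circleGraph t).commonNeighbors y z).eq_empty_or_nonempty
  · simp [hempty]
  simp only [SimpleGraph.mem_commonNeighbors, circleGraph_adj ht] at hu
  refine (Set.ncard_le_ncard (t := {u, y + z - u}) (fun v hv => ?_)).trans
    ((Set.ncard_insert_le _ _).trans_eq (by rw [Set.ncard_singleton]))
  simp only [SimpleGraph.mem_commonNeighbors, circleGraph_adj ht] at hv
  exact eq_or_eq_of_sub_mem_circle h2 ht hyz hu.1 hu.2 hv.1 hv.2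

variable [Fintype F]

theorem isRegularOfDegree_circleGraph (ht : t ≠ 0) :
    (circleGraph t).IsRegularOfDegree (circle t).ncard := by
  intro x
  have hnbr : (circleGraph t).neighborSet x = (fun v => x - v) '' circle t := by
    ext y
    rw [SimpleGraph.mem_neighborSet, circleGraph_adj ht]
    exact ⟨fun h => ⟨x - y, h, sub_sub_cancel x y⟩, by rintro ⟨v, hv, rfl⟩; simpa using hv⟩
  rw [← Set.ncard_image_of_injective _ sub_right_injective, ← hnbr,
    ← SimpleGraph.card_neighborSet_eq_degree, Set.ncard_eq_toFinset_card', Set.toFinset_card]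

theorem expect_nbrAvg_circleGraph_rpow_two_thirds_pow_three_le (h2 : (2 : F) ≠ 0) (ht : t ≠ 0)
    {f : (Fin 2 → F) → ℝ} (hf : ∀ x, 0 ≤ f x) :
    𝔼 x, nbrAvg (circleGraph t) (fun y => f y ^ (2 / 3 : ℝ)) x ^ 3 ≤ 48 * (𝔼 x, f x) ^ 2 := by
  have hcard : (Fintype.card (Fin 2 → F) : ℝ) ≤ 4 * ((circle t).ncard : ℝ) ^ 2 := by
    have : (Fintype.card F : ℝ) ≤ 2 * (circle t).ncard := by
      exact_mod_cast card_le_two_mul_ncard_circle h2 ht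
    calc (Fintype.card (Fin 2 → F) : ℝ) = (Fintype.card F : ℝ) ^ 2 := by simp
      _ ≤ (2 * ((circle t).ncard : ℝ)) ^ 2 := by gcongr
      _ = 4 * ((circle t).ncard : ℝ) ^ 2 := by ring
  refine (expect_nbrAvg_rpow_two_thirds_pow_three_le (isRegularOfDegree_circleGraph ht)
    (fun y z => ncard_commonNeighbors_circleGraph_le h2 ht) hcard hf).trans_eq ?_
  norm_num

end CircleGraph

/-! ### The `Y` form -/

section YForm

variable {F : Type*} [Field F] [Fintype F] {t : F}

theorem sum_circleInd_sub_mul (ht : t ≠ 0) (f : (Fin 2 → F) → ℝ) (x : Fin 2 → F) :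
    ∑ y, circleInd t (x - y) * f y = ∑ y ∈ (circleGraph t).neighborFinset x, f y := by
  classical
  simp only [SimpleGraph.neighborFinset_eq_filter, circleGraph_adj ht, Finset.sum_filter,
    circleInd, Set.indicator_apply, ite_mul, one_mul, zero_mul]

theorem yForm_eq_starAverage (ht : t ≠ 0) (f : Fin 4 → (Fin 2 → F) → ℝ) :
    yForm t f = starAverage (circleGraph t) (f 2) fun i : Fin 3 => f (Fin.succAbove 2 i) := by
  have hsum : ∑ x : Fin 4 → (Fin 2 → F), circleInd t (x 2 - x 0) * circleInd t (x 2 - x 1) *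
      circleInd t (x 2 - x 3) * ∏ l, f l (x l) = ∑ c, f 2 c *
        ∏ i : Fin 3, ∑ y ∈ (circleGraph t).neighborFinset c, f (Fin.succAbove 2 i) y := by
    rw [← (Fin.insertNthEquiv (fun _ => Fin 2 → F) 2).sum_comp, Fintype.sum_prod_type]
    refine Finset.sum_congr rfl fun c _ => ?_
    simp only [← sum_circleInd_sub_mul ht, Finset.prod_univ_sum, Fintype.piFinset_univ,
      Finset.mul_sum]
    refine Finset.sum_congr rfl fun y _ => ?_
    have hleaf (i : Fin 3) : Fin.insertNthEquiv (fun _ => Fin 2 → F) 2 (c, y)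
        (Fin.succAbove 2 i) = y i :=
      Fin.insertNth_apply_succAbove (α := fun _ => Fin 2 → F) 2 c y i
    rw [Fin.prod_univ_succAbove _ 2, Finset.prod_mul_distrib, Fin.prod_univ_three
      fun i => circleInd t (c - y i), mul_left_comm]
    simp only [hleaf]
    rw [show Fin.insertNthEquiv (fun _ => Fin 2 → F) 2 (c, y) 2 = c from
      Fin.insertNth_apply_same (α := fun _ => Fin 2 → F) 2 c y, ← hleaf 0, ← hleaf 1, ← hleaf 2]
    rfl
  simp only [yForm, hsum, starAverage, nbrAvg_eq_sum_div (isRegularOfDegree_circleGraph ht),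
    Finset.prod_div_distrib, Finset.prod_const, Fintype.expect_eq_sum_div_card, Finset.card_univ,
    Fintype.card_pi, Fintype.card_fin, Nat.cast_pow, mul_div_assoc', ← Finset.sum_div]
  field_simp

variable {p : Fin 4 → ℝ≥0∞}

theorem yForm_le_of_inv_toReal_add_sum_le (h2 : (2 : F) ≠ 0) (ht : t ≠ 0) (hp : ∀ l, p l ≠ 0)
    (hexp : ∀ l, (p l).toReal⁻¹ + ∑ k, (p k).toReal⁻¹ ≤ 2)
    {f : Fin 4 → (Fin 2 → F) → ℝ} (hf : ∀ l x, 0 ≤ f l x) :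
    yForm t f ≤ 48 * ∏ l, normLp (p l) (f l) := by
  simp only [Fin.sum_univ_succAbove _ (2 : Fin 4)] at hexp
  have hmem : ((p 2).toReal⁻¹, fun i : Fin 3 => (p (Fin.succAbove 2 i)).toReal⁻¹) ∈
      starRegion (Fin 3) (circleGraph t) 48 :=
    mem_starRegion (isRegularOfDegree_circleGraph ht) (by norm_num)
      (fun _ hf => expect_nbrAvg_circleGraph_rpow_two_thirds_pow_three_le h2 ht hf)
      (by positivity) (fun i => by positivity) (by linarith [hexp 2])
      fun j => by linarith [hexp (Fin.succAbove 2 j)]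
  rw [yForm_eq_starAverage ht, Fin.prod_univ_succAbove _ 2]
  exact starAverage_le_mul_normLp (hp 2) (fun i => hp _) hmem (hf 2) fun i => hf _

theorem yForm_le_card_pow_mul (h2 : (2 : F) ≠ 0) (ht : t ≠ 0) (hp : ∀ l, 1 ≤ p l)
    {f : Fin 4 → (Fin 2 → F) → ℝ} (hf : ∀ l x, 0 ≤ f l x) :
    yForm t f ≤ 48 * (Fintype.card F : ℝ) ^ 8 * ∏ l, normLp (p l) (f l) := calc
  yForm t f ≤ 48 * ∏ l, normLp ∞ (f l) :=
      yForm_le_of_inv_toReal_add_sum_le h2 ht (fun _ => ENNReal.top_ne_zero) (by simp) hf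
  _ ≤ 48 * ∏ l, Fintype.card (Fin 2 → F) * normLp (p l) (f l) := by
      gcongr with l
      · exact fun l _ => normLp_nonneg _ _
      · exact normLp_top_le_card_mul (hp l) (f l)
  _ = 48 * (Fintype.card F : ℝ) ^ 8 * ∏ l, normLp (p l) (f l) := by
      simp only [Finset.prod_mul_distrib, Finset.prod_const, Finset.card_univ, Fintype.card_pi,
        Fintype.card_fin, Nat.cast_pow]
      ring

end YForm

theorem uniformlyBounded_yForm_of_rpow_card_le {ι : Type*} {F : ι → Type*} [∀ i, Field (F i)]
    [∀ i, Fintype (F i)] (h2 : ∀ i, (2 : F i) ≠ 0) {t : ∀ i, F i} (ht : ∀ i, t i ≠ 0)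
    {p : Fin 4 → ℝ≥0∞} (hp : ∀ l, 1 ≤ p l) {δ B : ℝ} (hδ : 0 < δ)
    (hB : ∀ i, (Fintype.card (F i) : ℝ) ^ δ ≤ B) :
    UniformlyBounded F (fun i => yForm (t i)) p := by
  refine ⟨48 * max 1 (B ^ δ⁻¹) ^ 8, by positivity, fun i f hf =>
    (yForm_le_card_pow_mul (h2 i) (ht i) hp hf).trans ?_⟩
  have hq : (Fintype.card (F i) : ℝ) ≤ max 1 (B ^ δ⁻¹) := calc
    (Fintype.card (F i) : ℝ) = ((Fintype.card (F i) : ℝ) ^ δ) ^ δ⁻¹ :=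
        (Real.rpow_rpow_inv (Nat.cast_nonneg _) hδ.ne').symm
    _ ≤ B ^ δ⁻¹ := by gcongr; exact hB i
    _ ≤ max 1 (B ^ δ⁻¹) := le_max_right _ _
  have : 0 ≤ ∏ l, normLp (p l) (f l) := Finset.prod_nonneg fun l _ => normLp_nonneg _ _
  gcongr

/-! ### Testing the diamond form -/

section DiamondForm

variable {F : Type*} [Field F] [Fintype F] {t : F}

/-- The diamond is complete multipartite: two of its vertices are joined if and only if their
classes differ. -/
def diamondClass : Fin 4 → Fin 3 := ![0, 1, 2, 1]

theorem card_div_le_diamondForm {f : Fin 4 → (Fin 2 → F) → ℝ} (hf : ∀ l x, 0 ≤ f l x)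
    (A : Finset (Fin 4 → Fin 2 → F))
    (hdist : ∀ x ∈ A, ∀ k l, diamondClass k ≠ diamondClass l → x k - x l ∈ circle t)
    (hone : ∀ x ∈ A, ∀ l, f l (x l) = 1) :
    A.card / ((Fintype.card F : ℝ) ^ 2 * (circle t).ncard) ≤ diamondForm t f := by
  rw [div_eq_inv_mul, ← one_div, diamondForm]
  gcongr
  have hind (x : Fin 2 → F) : 0 ≤ circleInd t x := Set.indicator_nonneg (fun _ _ => zero_le_one) x
  refine le_trans (le_of_eq ?_) (Finset.sum_le_univ_sum_of_nonneg (s := A) fun x => ?_)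
  · rw [Finset.card_eq_sum_ones, Nat.cast_sum]
    refine Finset.sum_congr rfl fun x hx => ?_
    have hedge (k l : Fin 4) (hkl : diamondClass k ≠ diamondClass l) :
        circleInd t (x k - x l) = 1 := Set.indicator_of_mem (hdist x hx k l hkl) _
    simp [hedge 0 1 (by decide), hedge 1 2 (by decide), hedge 2 3 (by decide),
      hedge 3 0 (by decide), hedge 0 2 (by decide), hone x hx]
  · have := Finset.prod_nonneg fun l (_ : l ∈ Finset.univ) => hf l (x l)
    apply_rules [mul_nonneg]

/-- The sets on which the diamond form is tested: the vertices in the class of `l` are placed at the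
origin, the others on the circle. -/
def diamondTestSet (t : F) (l k : Fin 4) : Set (Fin 2 → F) :=
  if diamondClass k = diamondClass l then {0} else circle t

theorem inv_card_sq_le_diamondForm_diamondTestSet (h2 : (2 : F) ≠ 0) (h3 : IsSquare (3 : F))
    (t : F) (l : Fin 4) :
    ((Fintype.card F : ℝ) ^ 2)⁻¹ ≤ diamondForm t fun k => (diamondTestSet t l k).indicator 1 := by
  have hclass : ∀ l, ∃ k, diamondClass k - diamondClass l = 1 := by decide
  classical
  obtain ⟨r, hr⟩ := h3
  set φ : (Fin 2 → F) → Fin 4 → (Fin 2 → F) := fun u k =>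
    triangle r u (diamondClass k - diamondClass l)
  have hφ : Function.Injective φ := by
    intro u v huv
    obtain ⟨k, hk⟩ := hclass l
    simpa [φ, hk, triangle] using congrFun huv k
  have hmem {u : Fin 2 → F} (hu : u ∈ circle t) (k : Fin 4) : φ u k ∈ diamondTestSet t l k := by
    rw [diamondTestSet]
    split_ifs with h
    · simp [φ, h, triangle]
    · simpa [φ, triangle] using
        triangle_sub_triangle_mem_circle h2 hr hu (j := 0) (sub_ne_zero.2 h)
  refine le_trans (le_of_eq ?_) (card_div_le_diamondForm (fun k x => ?_)
    ((circle t).toFinset.image φ) ?_ ?_)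
  · rw [Finset.card_image_of_injective _ hφ, ← Set.ncard_eq_toFinset_card', ← div_div,
      div_right_comm, div_self, one_div]
    exact_mod_cast (ncard_circle_pos h2 t).ne'
  · exact Set.indicator_nonneg (fun _ _ => zero_le_one) x
  · simp only [Finset.forall_mem_image, Set.mem_toFinset]
    exact fun u hu k k' hkk' => triangle_sub_triangle_mem_circle h2 hr hu (by simpa using hkk')
  · simp only [Finset.forall_mem_image, Set.mem_toFinset]
    exact fun u hu k => Set.indicator_of_mem (hmem hu k) _

theorem ncard_diamondTestSet_div_le (t : F) (l k : Fin 4) :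
    ((diamondTestSet t l k).ncard / Fintype.card (Fin 2 → F) : ℝ) ≤
      2 / (Fintype.card F * if k = l then (Fintype.card F : ℝ) else 1) := by
  have hq : (1 : ℝ) ≤ Fintype.card F := by exact_mod_cast Fintype.card_pos (α := F)
  have hcircle : ((circle t).ncard : ℝ) ≤ 2 * Fintype.card F := by
    exact_mod_cast ncard_circle_le t
  have hcard : (Fintype.card (Fin 2 → F) : ℝ) = (Fintype.card F : ℝ) ^ 2 := by simp
  rw [hcard, div_le_div_iff₀ (by positivity) (by positivity), diamondTestSet]
  split_ifs with h h' h'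
  · rw [Set.ncard_singleton, Nat.cast_one]
    nlinarith
  · rw [Set.ncard_singleton, Nat.cast_one]
    nlinarith
  · exact absurd (congrArg diamondClass h') h
  · rw [mul_one]
    nlinarith

theorem rpow_card_le_of_diamondForm_le (h2 : (2 : F) ≠ 0) (h3 : IsSquare (3 : F))
    {p : Fin 4 → ℝ≥0∞} (hp : ∀ l, 1 ≤ p l) {C : ℝ} (hC : 0 ≤ C)
    (hbound : ∀ f : Fin 4 → (Fin 2 → F) → ℝ, (∀ l x, 0 ≤ f l x) →
      diamondForm t f ≤ C * ∏ l, normLp (p l) (f l)) (l : Fin 4) :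
    (Fintype.card F : ℝ) ^ ((p l).toReal⁻¹ + ∑ k, (p k).toReal⁻¹ - 2) ≤ 16 * C := by
  set q := (Fintype.card F : ℝ)
  have hq : 0 < q := Nat.cast_pos.2 Fintype.card_pos
  have hdenom : ∏ k, (q * if k = l then q else 1) ^ (p k).toReal⁻¹ =
      q ^ ((p l).toReal⁻¹ + ∑ k, (p k).toReal⁻¹) := by
    have hk (k : Fin 4) : (q * if k = l then q else 1) ^ (p k).toReal⁻¹ =
        q ^ (p k).toReal⁻¹ * if k = l then q ^ (p l).toReal⁻¹ else 1 := by
      split_ifs with h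
      · rw [h, Real.mul_rpow hq.le hq.le]
      · simp
    simp only [hk, Finset.prod_mul_distrib, Finset.prod_ite_eq', Finset.mem_univ, if_true]
    rw [Real.rpow_add hq, Real.rpow_sum_of_pos hq, mul_comm]
  have htest : (q ^ 2)⁻¹ ≤ 16 * C / q ^ ((p l).toReal⁻¹ + ∑ k, (p k).toReal⁻¹) := calc
    (q ^ 2)⁻¹ ≤ diamondForm t fun k => (diamondTestSet t l k).indicator 1 :=
        inv_card_sq_le_diamondForm_diamondTestSet h2 h3 t l
    _ ≤ C * ∏ k, normLp (p k) ((diamondTestSet t l k).indicator 1) :=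
        hbound _ fun k x => Set.indicator_nonneg (fun _ _ => zero_le_one) x
    _ ≤ C * ∏ k, 2 / (q * if k = l then q else 1) ^ (p k).toReal⁻¹ := by
        gcongr with k
        · exact fun k _ => normLp_nonneg _ _
        · exact normLp_indicator_one_le_two_div (hp k) (by positivity)
            (ncard_diamondTestSet_div_le t l k)
    _ = 16 * C / q ^ ((p l).toReal⁻¹ + ∑ k, (p k).toReal⁻¹) := by
        rw [Finset.prod_div_distrib, hdenom, Finset.prod_const, Finset.card_univ, Fintype.card_fin]
        ring
  rw [Real.rpow_sub hq, Real.rpow_two]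
  rw [le_div_iff₀ (by positivity)] at htest
  rwa [div_eq_inv_mul]

end DiamondForm

end FiniteFieldForms

end

open FiniteFieldForms in
theorem theorem10p5 {ι : Type*} (F : ι → Type*) [∀ i, Field (F i)] [∀ i, Fintype (F i)]
    (hodd : ∀ i, (2 : F i) ≠ 0) (hthree : ∀ i, IsSquare (3 : F i))
    (t : ∀ i, F i) (ht : ∀ i, t i ≠ 0)
    (p : Fin 4 → ENNReal) (hp : ∀ l, 1 ≤ p l)
    (hdiamond : FiniteFieldForms.UniformlyBounded F
      (fun i => FiniteFieldForms.diamondForm (t i)) p) :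
    FiniteFieldForms.UniformlyBounded F (fun i => FiniteFieldForms.yForm (t i)) p := by
  obtain ⟨C, hC, hbound⟩ := hdiamond
  by_cases! hexp : ∀ l, (p l).toReal⁻¹ + ∑ k, (p k).toReal⁻¹ ≤ 2
  · exact ⟨48, by norm_num, fun i f hf => yForm_le_of_inv_toReal_add_sum_le (hodd i) (ht i)
      (fun l => (zero_lt_one.trans_le (hp l)).ne') hexp hf⟩
  · obtain ⟨l, hl⟩ := hexp
    exact uniformlyBounded_yForm_of_rpow_card_le hodd ht hp (sub_pos.2 hl) fun i =>
      rpow_card_le_of_diamondForm_le (hodd i) (hthree i) hp hC.le (hbound i) l
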